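/- Let $n\ge 2$ and let $\mathcal G$ be the finite set of all directed graphs on the node set $[n]=\{1,\dots,n\}$ that have a self-loop at every node. Let $(\bar G(t))_{t\ge 0}$ be independent random elements of $\mathcal G$ with $\Pr(\bar G(t)=b)=p_b$ for all $t\ge 0$ and $b\in\mathcal G$, and assume that the union of the graphs $b$ with $p_b>0$ is strongly connected. Put $$\delta=\frac1{n^{2n}},\quad B=2n-2,\quad p=\Bigl(\min_{b:\,p_b>0}p_b\Bigr)^{2n-2},\quad \lambda=\Bigl(1-\frac1{n^{4nB/p}}\Bigr)^{p/(2nB)}.$$ Let $x(0)\in\mathbb R^n$ and let $\epsilon(t)$, $t\ge 1$, be random vectors in $\mathbb R^n$ (on the same probability space, with arbitrary dependence). Consider the modified perturbed-push algorithm: $y(0)=\mathbf 1$ and, for $t\ge 0$, $$w(t+1)=W(t)x(t),\quad y(t+1)=W(t)y(t),\quad z_i(t+1)=\frac{w_i(t+1)}{y_i(t+1)}\ (i\in[n]),\quad x(t+1)=w(t+1)+\epsilon(t+1),$$ where the effective graph $G(t)$ is obtained from $\bar G(t)$ by deleting every edge $(j,i)$, $i\neq j$, with $y_j(t)<\delta$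 (self-loops are kept), and the column-stochastic matrix $W(t)$ has entry $W_{ij}(t)=1/d_j(t)$ if $(j,i)$ is an edge of $G(t)$ and $W_{ij}(t)=0$ otherwise, $d_j(t)$ being the out-degree of $j$ in $G(t)$. Let $\bar x(t)=\frac1n\sum_{i=1}^n x_i(t)$. Let $\frac12<\gamma<1$, $\alpha(t)=t^{-\gamma}$ for $t\geq 1$, and suppose that for some $U>0$, almost surely, $\|\epsilon(t)\|_1\le U/t^{\gamma}$ for all $t\ge 1$. Then for every $i\in[n]$ and every $t\ge 0$ the random variable on the left-hand side below is integrable, and $$\mathbb E\left[\frac{1}{\sum_{k=0}^{t}\alpha(k+1)}\sum_{k=0}^{t}\alpha(k+1)\,\bigl|z_i(k+1)-\bar x(k)\bigr|\right]\le\frac{2c_2\Gamma}{\delta(1-\lambda)}\left(\|x(0)\|_1+U\Bigl(1+\frac1{2\gamma-1}\Bigr)\right),$$ where $c_2=15$ and $\Gamma=\dfrac{1-\gamma}{(t+2)^{1-\gamma}-1}$. -/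

import Mathlib

open MeasureTheory ProbabilityTheory

noncomputable section

namespace PerturbedPush

/-- Directed graphs on the node set `Fin n` having a self-loop at every node.
`G.Adj j i` means that `j` is connected to `i`, i.e. `i` can receive from `j`. -/
abbrev LoopDigraph (n : ℕ) : Type := {G : Digraph (Fin n) // ∀ i, G.Adj i i}

/-- The finite set of such graphs carries the discrete `σ`-algebra. -/
instance (n : ℕ) : MeasurableSpace (LoopDigraph n) := ⊤

/-- Between any ordered pair of nodes there is a directed path. -/
def StronglyConnected {V : Type*} (G : Digraph V) : Prop :=
  ∀ i j, Relation.ReflTransGen G.Adj i j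

/-- The assumption on the random graphs of available communication channels: at each time the
graph `b` occurs with probability `prob b`, the union of the graphs of positive probability is
strongly connected, and the graphs at different times are independent. -/
structure RandomGraphAssumption {n : ℕ} {Ω : Type*} [MeasurableSpace Ω] (μ : Measure Ω)
    (G : ℕ → Ω → LoopDigraph n) (prob : LoopDigraph n → ℝ) : Prop where
  measurable : ∀ t, Measurable (G t)
  law : ∀ t b, μ.real {ω | G t ω = b} = prob b
  union_connected : StronglyConnected (⨆ b : {b : LoopDigraph n // 0 < prob b}, b.1.1)
  independent : iIndepFun G μ

/-- The threshold `δ = 1 / n ^ (2 n)`. -/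
def delta (n : ℕ) : ℝ := 1 / (n : ℝ) ^ (2 * n)

/-- The effective communication graph: node `j` sends to the other nodes only if `y j ≥ δ`,
and every node always keeps its self-loop. -/
def effectiveGraph {n : ℕ} (G : LoopDigraph n) (y : Fin n → ℝ) : Digraph (Fin n) where
  Adj j i := G.1.Adj j i ∧ (j = i ∨ delta n ≤ y j)

/-- The out-degree of a node. -/
def outDegree {n : ℕ} (H : Digraph (Fin n)) (j : Fin n) : ℕ := {i | H.Adj j i}.ncard

open Classical in
/-- The weighted adjacency matrix: entry `(i, j)` is `1 / d_j` if `j` is an in-neighbor of `i`,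
and `0` otherwise. -/
def weightMatrix {n : ℕ} (H : Digraph (Fin n)) : Matrix (Fin n) (Fin n) ℝ :=
  Matrix.of fun i j => if H.Adj j i then 1 / (outDegree H j : ℝ) else 0

/-! The algorithm along one realization `G 0, G 1, …` of the graphs and `ε 1, ε 2, …` of the
perturbations. -/

/-- `y 0 = 1` and `y (t + 1) = W t y t`. -/
def mppY {n : ℕ} (G : ℕ → LoopDigraph n) : ℕ → Fin n → ℝ
  | 0 => fun _ => 1
  | t + 1 => (weightMatrix (effectiveGraph (G t) (mppY G t))).mulVec (mppY G t)

/-- The matrix `W t` of the effective communication graph at time `t`. -/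
def mppMatrix {n : ℕ} (G : ℕ → LoopDigraph n) (t : ℕ) : Matrix (Fin n) (Fin n) ℝ :=
  weightMatrix (effectiveGraph (G t) (mppY G t))

/-- `x 0 = x₀` and `x (t + 1) = W t x t + ε (t + 1)`. -/
def mppX {n : ℕ} (G : ℕ → LoopDigraph n) (x₀ : Fin n → ℝ) (ε : ℕ → Fin n → ℝ) :
    ℕ → Fin n → ℝ
  | 0 => x₀
  | t + 1 => (mppMatrix G t).mulVec (mppX G x₀ ε t) + ε (t + 1)

/-- `w (t + 1) = W t x t`. The algorithm has no `w 0`; the value given here is never used. -/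
def mppW {n : ℕ} (G : ℕ → LoopDigraph n) (x₀ : Fin n → ℝ) (ε : ℕ → Fin n → ℝ) :
    ℕ → Fin n → ℝ
  | 0 => 0
  | t + 1 => (mppMatrix G t).mulVec (mppX G x₀ ε t)

/-- `z_i t = w_i t / y_i t`, the estimate of node `i` at time `t ≥ 1`. -/
def mppZ {n : ℕ} (G : ℕ → LoopDigraph n) (x₀ : Fin n → ℝ) (ε : ℕ → Fin n → ℝ)
    (t : ℕ) (i : Fin n) : ℝ :=
  mppW G x₀ ε t i / mppY G t i

/-- The average `(1 / n) ∑ i, x_i t`. -/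
def mppAvg {n : ℕ} (G : ℕ → LoopDigraph n) (x₀ : Fin n → ℝ) (ε : ℕ → Fin n → ℝ)
    (t : ℕ) : ℝ :=
  (∑ i, mppX G x₀ ε t i) / n

/-- The `1`-norm on `ℝⁿ`. -/
def norm1 {n : ℕ} (v : Fin n → ℝ) : ℝ := ∑ i, |v i|

/-- The step size `α(t) = 1 / t ^ γ`. -/
def stepSize (γ : ℝ) (t : ℕ) : ℝ := 1 / (t : ℝ) ^ γ

/-- `Γ = (1 - γ) / ((t + 2) ^ (1 - γ) - 1)`. -/
def rate (γ : ℝ) (t : ℕ) : ℝ := (1 - γ) / (((t : ℝ) + 2) ^ (1 - γ) - 1)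

/-- The smallest positive probability of a graph. -/
def minProb {n : ℕ} (prob : LoopDigraph n → ℝ) : ℝ := sInf {r | 0 < r ∧ ∃ b, prob b = r}

/-- `B = 2 n - 2` (used for `n ≥ 2`). -/
def windowLength (n : ℕ) : ℕ := 2 * n - 2

/-- `p = (min_{b : p_b > 0} p_b) ^ (2 n - 2)`. -/
def windowProb {n : ℕ} (prob : LoopDigraph n → ℝ) : ℝ := minProb prob ^ windowLength n

/-- `λ = (1 - 1 / n ^ (4 n B / p)) ^ (p / (2 n B))`. -/
def lam {n : ℕ} (prob : LoopDigraph n → ℝ) : ℝ :=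
  (1 - 1 / (n : ℝ) ^ (4 * (n : ℝ) * (windowLength n : ℝ) / windowProb prob)) ^
    (windowProb prob / (2 * (n : ℝ) * (windowLength n : ℝ)))

end PerturbedPush

end

/-!
The disagreement vector `v k = x k - x̄ k • y k` has entries summing to zero, because every weight
matrix is column-stochastic and `y k` has total mass `n`. It satisfies
`v (k + 1) = W k v k + (noise of norm at most 2 ‖ε (k + 1)‖₁)`, and `z (k + 1) - x̄ k` is `W k v k`
divided entrywise by `y (k + 1)`. Masses never fall below `δ / n` (`le_mppY`), so the error of every
node is at most `(n / δ) ‖v k‖₁`, and it remains to bound `∑ α (k + 1) E ‖v k‖₁`.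

Column-stochastic matrices do not increase the `1`-norm, and one with a row bounded below by `η`
contracts it by `1 - η` on vectors of sum zero (`ColStochastic.norm1_mulVec_le_of_row`). Whatever
the current masses are, some node has mass at least `1`. Using strong connectivity of the union,
`n - 1` suitable graphs spread its mass to all nodes, which leaves every node well above `δ`; for
the following `n - 1` steps no edge is deleted, and suitable graphs make every node send to one
common node. So each mass vector admits a window of `2 n - 2` graphs of positive probability
contracting `v` by `1 - η` with `η = 1 / n ^ (n - 1)` (`exists_contracting_window`). Given the past,
this window occurs with probability at least `p` (`windowProb_mul_integral_le`).

The perturbations may depend on future graphs, so `‖v k‖₁` cannot be treated as independent of the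
next window. It is therefore first bounded by the process `majorant`, which obeys the same recursion
with the deterministic noise bound `U / k ^ γ` and depends on the past graphs only. Its expectation
shrinks by `1 - η p` per window up to the noise (`integral_majorant_add_le`), and summing this
against the decreasing weights `α` gives a bound proportional to `1 / (η p)`
(`mul_sum_stepSize_mul_le`). Finally `1 - λ` is so small that `n / (η p)` is absorbed in `1 / (1 - λ)`
(`lam_bounds`).
-/

namespace PerturbedPush

/-! ### Column-stochastic matrices -/

/-- Entrywise nonnegative, with every column summing to `1`. -/
structure ColStochastic {n : ℕ} (P : Matrix (Fin n) (Fin n) ℝ) : Prop where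
  nonneg : ∀ i j, 0 ≤ P i j
  sum_col : ∀ j, ∑ i, P i j = 1

variable {n : ℕ}

lemma norm1_nonneg (v : Fin n → ℝ) : 0 ≤ norm1 v :=
  Finset.sum_nonneg fun _ _ => abs_nonneg _

lemma norm1_add_le (v w : Fin n → ℝ) : norm1 (v + w) ≤ norm1 v + norm1 w := by
  unfold norm1
  rw [← Finset.sum_add_distrib]
  exact Finset.sum_le_sum fun i _ => abs_add_le _ _

lemma abs_le_norm1 (v : Fin n → ℝ) (i : Fin n) : |v i| ≤ norm1 v :=
  Finset.single_le_sum (f := fun i => |v i|) (fun _ _ => abs_nonneg _) (Finset.mem_univ i)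

lemma abs_sum_le_norm1 (v : Fin n → ℝ) : |∑ i, v i| ≤ norm1 v :=
  Finset.abs_sum_le_sum_abs _ _

lemma norm1_mulVec_le_of_sum_col {P : Matrix (Fin n) (Fin n) ℝ} {c : ℝ}
    (h0 : ∀ i j, 0 ≤ P i j) (hc : ∀ j, ∑ i, P i j = c) (v : Fin n → ℝ) :
    norm1 (P.mulVec v) ≤ c * norm1 v := by
  calc norm1 (P.mulVec v) ≤ ∑ i, ∑ j, P i j * |v j| := by
        refine Finset.sum_le_sum fun i _ => ?_
        refine (Finset.abs_sum_le_sum_abs (fun j => P i j * v j) Finset.univ).trans (le_of_eq ?_)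
        exact Finset.sum_congr rfl fun j _ => by rw [abs_mul, abs_of_nonneg (h0 i j)]
    _ = c * norm1 v := by
        rw [Finset.sum_comm, norm1, Finset.mul_sum]
        exact Finset.sum_congr rfl fun j _ => by rw [← Finset.sum_mul, hc]

namespace ColStochastic

lemma one : ColStochastic (1 : Matrix (Fin n) (Fin n) ℝ) :=
  ⟨fun i j => by rw [Matrix.one_apply]; split_ifs <;> norm_num,
    fun j => by simp [Matrix.one_apply]⟩

lemma sum_mulVec {P : Matrix (Fin n) (Fin n) ℝ} (hP : ColStochastic P) (v : Fin n → ℝ) :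
    ∑ i, P.mulVec v i = ∑ i, v i := by
  simp only [Matrix.mulVec, dotProduct]
  rw [Finset.sum_comm]
  exact Finset.sum_congr rfl fun j _ => by rw [← Finset.sum_mul, hP.sum_col, one_mul]

lemma mul {P Q : Matrix (Fin n) (Fin n) ℝ} (hP : ColStochastic P) (hQ : ColStochastic Q) :
    ColStochastic (P * Q) where
  nonneg i j := by
    rw [Matrix.mul_apply]
    exact Finset.sum_nonneg fun k _ => mul_nonneg (hP.nonneg _ _) (hQ.nonneg _ _)
  sum_col j := (hP.sum_mulVec fun k => Q k j).trans (hQ.sum_col j)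

lemma mulVec_nonneg {P : Matrix (Fin n) (Fin n) ℝ} (hP : ColStochastic P) {y : Fin n → ℝ}
    (hy : ∀ i, 0 ≤ y i) (i : Fin n) : 0 ≤ P.mulVec y i :=
  Finset.sum_nonneg (s := Finset.univ) (f := fun j => P i j * y j) fun j _ => mul_nonneg (hP.nonneg i j) (hy j)

lemma norm1_mulVec_le {P : Matrix (Fin n) (Fin n) ℝ} (hP : ColStochastic P) (v : Fin n → ℝ) :
    norm1 (P.mulVec v) ≤ norm1 v := by
  simpa using norm1_mulVec_le_of_sum_col hP.nonneg hP.sum_col v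

/-- Doeblin's contraction: if the row `r` of a column-stochastic matrix is bounded below by `η`,
then subtracting `η` from that row does not change the action on vectors of sum zero, and leaves a
nonnegative matrix with column sums `1 - η`. -/
lemma norm1_mulVec_le_of_row {P : Matrix (Fin n) (Fin n) ℝ} (hP : ColStochastic P) {η : ℝ}
    {r : Fin n} (hr : ∀ j, η ≤ P r j) {v : Fin n → ℝ} (hv : ∑ i, v i = 0) :
    norm1 (P.mulVec v) ≤ (1 - η) * norm1 v := by
  let Q : Matrix (Fin n) (Fin n) ℝ := Matrix.of fun i j => P i j - if i = r then η else 0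
  have hQ : P.mulVec v = Q.mulVec v := by
    ext i
    simp only [Matrix.mulVec, dotProduct, Q, Matrix.of_apply, sub_mul, Finset.sum_sub_distrib,
      ← Finset.mul_sum, hv, mul_zero, sub_zero]
  rw [hQ]
  refine norm1_mulVec_le_of_sum_col (fun i j => ?_) (fun j => ?_) v
  · simp only [Q, Matrix.of_apply]
    split_ifs with h
    · rw [h]; linarith [hr j]
    · simpa using hP.nonneg i j
  · simp [Q, Finset.sum_sub_distrib, hP.sum_col]

end ColStochastic

/-! ### The weight matrix of a graph with self-loops -/

lemma outDegree_pos {H : Digraph (Fin n)} {j : Fin n} (hH : H.Adj j j) : 0 < outDegree H j :=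
  (Set.ncard_pos (Set.toFinite _)).2 ⟨j, hH⟩

lemma outDegree_le (H : Digraph (Fin n)) (j : Fin n) : outDegree H j ≤ n := by
  have := Set.ncard_le_ncard (Set.subset_univ {i | H.Adj j i})
  simpa [outDegree] using this

lemma weightMatrix_colStochastic {H : Digraph (Fin n)} (hH : ∀ i, H.Adj i i) :
    ColStochastic (weightMatrix H) where
  nonneg i j := by
    simp only [weightMatrix, Matrix.of_apply]
    split_ifs <;> positivity
  sum_col j := by
    classical
    have h0 : (outDegree H j : ℝ) ≠ 0 := by exact_mod_cast (outDegree_pos (hH j)).ne'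
    have h1 : outDegree H j = (Finset.univ.filter fun i => H.Adj j i).card := by
      rw [outDegree, ← Set.ncard_coe_finset]
      congr 1
      ext i; simp
    simp only [weightMatrix, Matrix.of_apply]
    rw [← Finset.sum_filter, Finset.sum_const, nsmul_eq_mul]
    rw [h1] at h0 ⊢
    convert mul_one_div_cancel h0

lemma inv_le_weightMatrix {H : Digraph (Fin n)} (hH : ∀ i, H.Adj i i) {i j : Fin n}
    (h : H.Adj j i) : (n : ℝ)⁻¹ ≤ weightMatrix H i j := by
  simp only [weightMatrix, Matrix.of_apply, if_pos h, one_div]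
  have := outDegree_pos (hH j)
  gcongr
  exact outDegree_le H j

lemma effectiveGraph_loop (b : LoopDigraph n) (y : Fin n → ℝ) (i : Fin n) :
    (effectiveGraph b y).Adj i i := ⟨b.2 i, Or.inl rfl⟩

/-- The weight matrix of one step with available graph `b` and mass vector `y`. -/
noncomputable def stepMatrix (b : LoopDigraph n) (y : Fin n → ℝ) : Matrix (Fin n) (Fin n) ℝ :=
  weightMatrix (effectiveGraph b y)

lemma stepMatrix_colStochastic (b : LoopDigraph n) (y : Fin n → ℝ) :
    ColStochastic (stepMatrix b y) :=
  weightMatrix_colStochastic (effectiveGraph_loop b y)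

lemma inv_le_stepMatrix_self (b : LoopDigraph n) (y : Fin n → ℝ) (i : Fin n) :
    (n : ℝ)⁻¹ ≤ stepMatrix b y i i :=
  inv_le_weightMatrix (effectiveGraph_loop b y) (effectiveGraph_loop b y i)

lemma inv_le_stepMatrix_of_adj {b : LoopDigraph n} {y : Fin n → ℝ} {i j : Fin n}
    (h : b.1.Adj j i) (hy : delta n ≤ y j) : (n : ℝ)⁻¹ ≤ stepMatrix b y i j :=
  inv_le_weightMatrix (effectiveGraph_loop b y) ⟨h, Or.inr hy⟩

lemma stepMatrix_self_of_lt {b : LoopDigraph n} {y : Fin n → ℝ} {i : Fin n}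
    (hy : y i < delta n) : stepMatrix b y i i = 1 := by
  have h : {k | (effectiveGraph b y).Adj i k} = {i} := by
    ext k
    simp only [effectiveGraph, Set.mem_ofPred_eq, Set.mem_singleton_iff, not_le.2 hy, or_false]
    exact ⟨fun h => h.2.symm, fun h => by subst h; exact ⟨b.2 _, rfl⟩⟩
  simp only [stepMatrix, weightMatrix, Matrix.of_apply, if_pos (effectiveGraph_loop b y i),
    outDegree, h, Set.ncard_singleton]
  norm_num

lemma mul_le_mulVec {P : Matrix (Fin n) (Fin n) ℝ} (hP : ∀ i j, 0 ≤ P i j) {y : Fin n → ℝ}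
    (hy : ∀ i, 0 ≤ y i) (i j : Fin n) : P i j * y j ≤ P.mulVec y i :=
  Finset.single_le_sum (f := fun j => P i j * y j) (fun j _ => mul_nonneg (hP i j) (hy j))
    (Finset.mem_univ j)

/-! ### Runs along a finite list of graphs -/

/-- The mass vector after the available graphs of a list have acted on `y`, the head first. -/
noncomputable def runMass : List (LoopDigraph n) → (Fin n → ℝ) → Fin n → ℝ
  | [], y => y
  | b :: l, y => runMass l ((stepMatrix b y).mulVec y)

/-- The product of the weight matrices met by a run along a list of graphs started from the mass
vector `y`; the head of the list gives the rightmost factor. -/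
noncomputable def runMatrix : List (LoopDigraph n) → (Fin n → ℝ) → Matrix (Fin n) (Fin n) ℝ
  | [], _ => 1
  | b :: l, y => runMatrix l ((stepMatrix b y).mulVec y) * stepMatrix b y

lemma runMass_append (l l' : List (LoopDigraph n)) (y : Fin n → ℝ) :
    runMass (l ++ l') y = runMass l' (runMass l y) := by
  induction l generalizing y with
  | nil => rfl
  | cons b l ih => exact ih _

lemma runMatrix_append (l l' : List (LoopDigraph n)) (y : Fin n → ℝ) :
    runMatrix (l ++ l') y = runMatrix l' (runMass l y) * runMatrix l y := by
  induction l generalizing y with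
  | nil => simp [runMatrix, runMass]
  | cons b l ih => simp [runMatrix, runMass, ih, Matrix.mul_assoc]

lemma runMatrix_colStochastic (l : List (LoopDigraph n)) (y : Fin n → ℝ) :
    ColStochastic (runMatrix l y) := by
  induction l generalizing y with
  | nil => exact ColStochastic.one
  | cons b l ih => exact (ih _).mul (stepMatrix_colStochastic b y)

/-! ### A contracting window of graphs -/

/-- A path leading out of `S` has an edge leaving `S`. -/
lemma exists_boundary_edge {V : Type*} {G : Digraph V} (hG : StronglyConnected G) {S : V → Prop}
    {a b : V} (ha : S a) (hb : ¬ S b) : ∃ j i, S j ∧ ¬ S i ∧ G.Adj j i := by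
  by_contra! h
  refine hb ?_
  induction hG a b with
  | refl => exact ha
  | @tail c d _ hcd ih =>
    have hc : S c := by
      by_contra hc
      exact hc (ih hc)
    by_contra hd
    exact h c d hc hd hcd

/-- The union of the graphs of positive probability. -/
def supportUnion (prob : LoopDigraph n → ℝ) : Digraph (Fin n) :=
  ⨆ b : {b : LoopDigraph n // 0 < prob b}, b.1.1

lemma supportUnion_adj {prob : LoopDigraph n → ℝ} {j i : Fin n}
    (h : (supportUnion prob).Adj j i) : ∃ b : LoopDigraph n, 0 < prob b ∧ b.1.Adj j i := by
  unfold supportUnion at h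
  rw [Digraph.iSup_adj] at h
  obtain ⟨b, hb⟩ := h
  exact ⟨b.1, b.2, hb⟩

lemma exists_prob_pos (hn : 2 ≤ n) {prob : LoopDigraph n → ℝ}
    (hG : StronglyConnected (supportUnion prob)) : ∃ b, 0 < prob b := by
  obtain ⟨j, i, _, _, h⟩ := exists_boundary_edge hG (S := fun v => v = ⟨0, by omega⟩)
    (a := ⟨0, by omega⟩) (b := ⟨1, by omega⟩) rfl (by simp)
  obtain ⟨b, hb, _⟩ := supportUnion_adj h
  exact ⟨b, hb⟩

/-- Spreading mass: as long as the nodes of `R` carry mass at least `δ`, one more node can be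
reached per step, at the cost of a factor `n` for the mass. -/
lemma exists_list_runMass (hn : 2 ≤ n) {prob : LoopDigraph n → ℝ}
    (hG : StronglyConnected (supportUnion prob)) (m : ℕ) {y : Fin n → ℝ} {a : ℝ} {R : Finset (Fin n)}
    (hy : ∀ i, 0 ≤ y i) (ha : delta n * n ^ m ≤ a) (hR : ∀ i ∈ R, a ≤ y i) (hR0 : R.Nonempty)
    (hRm : n ≤ R.card + m) :
    ∃ l : List (LoopDigraph n), l.length = m ∧ (∀ b ∈ l, 0 < prob b) ∧
      ∀ i, a / n ^ m ≤ runMass l y i := by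
  classical
  have hn0 : (0 : ℝ) < n := by positivity
  induction m generalizing y a R with
  | zero =>
    refine ⟨[], rfl, by simp, fun i => ?_⟩
    have : R = Finset.univ := by
      rw [← Finset.card_eq_iff_eq_univ, Fintype.card_fin]
      exact le_antisymm (by simpa using R.card_le_univ) (by simpa using hRm)
    simpa [runMass] using hR i (by simp [this])
  | succ m ih =>
    have hδ : 0 ≤ delta n := by unfold delta; positivity
    have h1 : (1 : ℝ) ≤ n := by exact_mod_cast (by omega : 1 ≤ n)
    have haδ : delta n ≤ a := le_trans (le_mul_of_one_le_right hδ (one_le_pow₀ h1)) ha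
    have ha' : delta n * n ^ m ≤ a / n := by
      rw [le_div_iff₀ hn0]; rw [pow_succ, ← mul_assoc] at ha; exact ha
    have hkey : ∃ b : LoopDigraph n, 0 < prob b ∧ ∃ R' : Finset (Fin n), R'.Nonempty ∧
        n ≤ R'.card + m ∧ ∀ i ∈ R', a / n ≤ (stepMatrix b y).mulVec y i := by
      have hself : ∀ b : LoopDigraph n, ∀ i ∈ R, a / n ≤ (stepMatrix b y).mulVec y i := by
        intro b i hi
        refine le_trans ?_ (mul_le_mulVec (stepMatrix_colStochastic b y).nonneg hy i i)
        rw [div_eq_inv_mul]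
        exact mul_le_mul (inv_le_stepMatrix_self b y i) (hR i hi) (hδ.trans haδ)
          ((stepMatrix_colStochastic b y).nonneg _ _)
      by_cases hRu : R = Finset.univ
      · obtain ⟨b, hb⟩ := exists_prob_pos hn hG
        refine ⟨b, hb, R, hR0, ?_, hself b⟩
        rw [hRu, Finset.card_univ, Fintype.card_fin]; omega
      · obtain ⟨k, hk⟩ : ∃ k, k ∉ R := by
          by_contra! h
          exact hRu (Finset.eq_univ_iff_forall.2 h)
        obtain ⟨r, hr⟩ := hR0
        obtain ⟨j, i, hj, hi, hji⟩ := exists_boundary_edge hG (S := fun v => v ∈ R) hr hk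
        obtain ⟨b, hb, hbji⟩ := supportUnion_adj hji
        refine ⟨b, hb, insert i R, Finset.insert_nonempty _ _, ?_, fun i' hi' => ?_⟩
        · rw [Finset.card_insert_of_notMem hi]; omega
        · rcases Finset.mem_insert.1 hi' with rfl | hi'
          · refine le_trans ?_ (mul_le_mulVec (stepMatrix_colStochastic b y).nonneg hy i' j)
            rw [div_eq_inv_mul]
            exact mul_le_mul (inv_le_stepMatrix_of_adj hbji (haδ.trans (hR j hj))) (hR j hj)
              (hδ.trans haδ) ((stepMatrix_colStochastic b y).nonneg _ _)
          · exact hself b i' hi'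
    obtain ⟨b, hb, R', hR'0, hR'm, hR'⟩ := hkey
    obtain ⟨l, hl, hlp, hle⟩ := ih (y := (stepMatrix b y).mulVec y)
      ((stepMatrix_colStochastic b y).mulVec_nonneg hy) ha' hR' hR'0 hR'm
    refine ⟨b :: l, by simp [hl], ?_, fun i => ?_⟩
    · intro c hc
      rcases List.mem_cons.1 hc with rfl | hc
      · exact hb
      · exact hlp c hc
    · rw [pow_succ', ← div_div]
      exact hle i

/-- Funnelling into a node `r`: while every node has mass at least `δ` no edge is deleted, and the
set of nodes from which `r` receives can be enlarged by one node per step, building the list of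
graphs backwards in time. -/
lemma exists_list_runMatrix (hn : 2 ≤ n) {prob : LoopDigraph n → ℝ}
    (hG : StronglyConnected (supportUnion prob)) (r : Fin n) (m : ℕ) :
    ∃ l : List (LoopDigraph n), l.length = m ∧ (∀ b ∈ l, 0 < prob b) ∧
      ∃ R : Finset (Fin n), r ∈ R ∧ min n (m + 1) ≤ R.card ∧
        ∀ y : Fin n → ℝ, (∀ i, delta n * n ^ m ≤ y i) →
          ∀ j ∈ R, ((n : ℝ) ^ m)⁻¹ ≤ runMatrix l y r j := by
  classical
  have hn0 : (0 : ℝ) < n := by positivity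
  have hδ : 0 ≤ delta n := by unfold delta; positivity
  have h1 : (1 : ℝ) ≤ n := by exact_mod_cast (by omega : 1 ≤ n)
  induction m with
  | zero =>
    refine ⟨[], rfl, by simp, {r}, by simp, by simp, fun y _ j hj => ?_⟩
    obtain rfl := Finset.mem_singleton.1 hj
    simp [runMatrix]
  | succ m ih =>
    obtain ⟨l, hl, hlp, R, hrR, hRc, hR⟩ := ih
    have hstep : ∀ (b : LoopDigraph n) (y : Fin n → ℝ), (∀ i, delta n * n ^ (m + 1) ≤ y i) →
        ∀ i j, i ∈ R → (n : ℝ)⁻¹ ≤ stepMatrix b y i j →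
          ((n : ℝ) ^ (m + 1))⁻¹ ≤ runMatrix (b :: l) y r j := by
      intro b y hy i j hi hij
      have hy0 : ∀ i, 0 ≤ y i := fun i => le_trans (by positivity) (hy i)
      have hy' : ∀ i, delta n * n ^ m ≤ (stepMatrix b y).mulVec y i := by
        intro k
        refine le_trans ?_ (mul_le_mulVec (stepMatrix_colStochastic b y).nonneg hy0 k k)
        calc delta n * n ^ m = (n : ℝ)⁻¹ * (delta n * n ^ (m + 1)) := by
              rw [pow_succ]; field_simp
          _ ≤ _ := mul_le_mul (inv_le_stepMatrix_self b y k) (hy k) (by positivity)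
              ((stepMatrix_colStochastic b y).nonneg _ _)
      have h2 := hR _ hy' i hi
      have hnn := (runMatrix_colStochastic l ((stepMatrix b y).mulVec y)).nonneg
      calc ((n : ℝ) ^ (m + 1))⁻¹ = ((n : ℝ) ^ m)⁻¹ * (n : ℝ)⁻¹ := by rw [pow_succ, mul_inv]
        _ ≤ runMatrix l ((stepMatrix b y).mulVec y) r i * stepMatrix b y i j :=
            mul_le_mul h2 hij (by positivity) (hnn _ _)
        _ ≤ runMatrix (b :: l) y r j :=
            Finset.single_le_sum (f := fun i => runMatrix l ((stepMatrix b y).mulVec y) r i *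
              stepMatrix b y i j) (fun k _ => mul_nonneg (hnn _ _)
                ((stepMatrix_colStochastic b y).nonneg _ _)) (Finset.mem_univ i)
    have hcons : ∀ b, 0 < prob b → ∀ c ∈ b :: l, 0 < prob c := by
      intro b hb c hc
      rcases List.mem_cons.1 hc with rfl | hc
      · exact hb
      · exact hlp c hc
    by_cases hRu : R = Finset.univ
    · obtain ⟨b, hb⟩ := exists_prob_pos hn hG
      refine ⟨b :: l, by simp [hl], hcons b hb, R, hrR, ?_, fun y hy j hj =>
        hstep b y hy j j hj (inv_le_stepMatrix_self b y j)⟩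
      rw [hRu, Finset.card_univ, Fintype.card_fin]; omega
    · obtain ⟨k, hk⟩ : ∃ k, k ∉ R := by
        by_contra! h
        exact hRu (Finset.eq_univ_iff_forall.2 h)
      obtain ⟨j, i, hj, hi, hji⟩ := exists_boundary_edge hG (S := fun v => v ∉ R) hk
        (not_not.2 hrR)
      obtain ⟨b, hb, hbji⟩ := supportUnion_adj hji
      rw [not_not] at hi
      refine ⟨b :: l, by simp [hl], hcons b hb, insert j R, by simp [hrR], ?_, ?_⟩
      · rw [Finset.card_insert_of_notMem hj]; omega
      · intro y hy j' hj'
        rcases Finset.mem_insert.1 hj' with rfl | hj'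
        · refine hstep b y hy i j' hi (inv_le_stepMatrix_of_adj hbji (le_trans ?_ (hy j')))
          exact le_mul_of_one_le_right hδ (one_le_pow₀ h1)
        · exact hstep b y hy j' j' hj' (inv_le_stepMatrix_self b y j')

/-- The contraction `1 - η` gained along a favourable window has `η = 1 / n ^ (n - 1)`. -/
noncomputable def gain (n : ℕ) : ℝ := ((n : ℝ) ^ (n - 1))⁻¹

/-- For every mass vector there is a window of `2 n - 2` graphs of positive probability along which
the `1`-norm of vectors of sum zero shrinks by the factor `1 - η`: the first `n - 1` graphs raise
all masses, starting from a node of mass at least `1`, and the last `n - 1` graphs let every node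
send to one common node. -/
lemma exists_contracting_window (hn : 2 ≤ n) {prob : LoopDigraph n → ℝ}
    (hG : StronglyConnected (supportUnion prob)) {y : Fin n → ℝ} (hy : ∀ i, 0 ≤ y i)
    (hys : ∑ i, y i = n) :
    ∃ g : ℕ → LoopDigraph n, (∀ j < windowLength n, 0 < prob (g j)) ∧
      ∀ v : Fin n → ℝ, ∑ i, v i = 0 →
        norm1 ((runMatrix ((List.range (windowLength n)).map g) y).mulVec v)
          ≤ (1 - gain n) * norm1 v := by
  have hn0 : (0 : ℝ) < n := by positivity
  have h1 : (1 : ℝ) ≤ n := by exact_mod_cast (by omega : 1 ≤ n)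
  obtain ⟨r, hr⟩ : ∃ r, 1 ≤ y r := by
    by_contra! h
    have : Nonempty (Fin n) := ⟨⟨0, by omega⟩⟩
    have := Finset.sum_lt_sum_of_nonempty (s := Finset.univ) Finset.univ_nonempty
      (fun i _ => h i)
    simp [hys] at this
  -- `δ * n ^ (2 n - 2) ≤ 1`, so the threshold is never active on reached nodes
  have hδ2 : delta n * n ^ (n - 1) * n ^ (n - 1) ≤ 1 := by
    rw [delta, mul_assoc, ← pow_add, one_div, inv_mul_le_one₀ (by positivity)]
    exact pow_le_pow_right₀ h1 (by omega)
  have hδ1 : delta n * n ^ (n - 1) ≤ 1 := by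
    refine le_trans (le_mul_of_one_le_right ?_ (one_le_pow₀ h1)) hδ2
    unfold delta; positivity
  obtain ⟨l₁, hl₁, hp₁, hm⟩ := exists_list_runMass hn hG (n - 1) (a := 1) (R := {r}) hy hδ1
    (by simpa using hr) (by simp) (by simp; omega)
  obtain ⟨l₂, hl₂, hp₂, R, -, hRc, hR⟩ := exists_list_runMatrix hn hG r (n - 1)
  have hRu : R = Finset.univ := by
    rw [← Finset.card_eq_iff_eq_univ, Fintype.card_fin]
    exact le_antisymm (by simpa using R.card_le_univ) (le_trans (by rw [le_min_iff]; omega) hRc)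
  have hlen : (l₁ ++ l₂).length = windowLength n := by
    simp [hl₁, hl₂, windowLength]; omega
  obtain ⟨b₀, -⟩ := exists_prob_pos hn hG
  have hmap : (List.range (windowLength n)).map (fun j => (l₁ ++ l₂).getD j b₀) = l₁ ++ l₂ := by
    refine List.ext_getElem (by simp [← hlen]) fun j h h' => ?_
    rw [List.getElem_map, List.getElem_range, List.getD_eq_getElem _ _ h']
  refine ⟨fun j => (l₁ ++ l₂).getD j b₀, fun j hj => ?_, fun v hv => ?_⟩
  · rw [← hlen] at hj
    beta_reduce
    rw [List.getD_eq_getElem _ _ hj]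
    rcases List.mem_append.1 (List.getElem_mem hj) with h | h
    · exact hp₁ _ h
    · exact hp₂ _ h
  · rw [hmap, runMatrix_append, ← Matrix.mulVec_mulVec]
    have hgain : 0 ≤ 1 - gain n := sub_nonneg.2 (inv_le_one_of_one_le₀ (one_le_pow₀ h1))
    refine ((runMatrix_colStochastic l₂ _).norm1_mulVec_le_of_row (η := gain n) (r := r)
      (fun j => hR _ (fun i => le_trans ?_ (hm i)) j (by simp [hRu])) ?_).trans
      (mul_le_mul_of_nonneg_left ((runMatrix_colStochastic l₁ y).norm1_mulVec_le v) hgain)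
    · rw [le_div_iff₀ (by positivity)]; exact hδ2
    · rw [(runMatrix_colStochastic l₁ y).sum_mulVec, hv]

/-! ### The mass vector along a realization -/

lemma mppMatrix_eq (G : ℕ → LoopDigraph n) (t : ℕ) :
    mppMatrix G t = stepMatrix (G t) (mppY G t) := rfl

lemma mppY_succ (G : ℕ → LoopDigraph n) (t : ℕ) :
    mppY G (t + 1) = (mppMatrix G t).mulVec (mppY G t) := rfl

lemma mppMatrix_colStochastic (G : ℕ → LoopDigraph n) (t : ℕ) : ColStochastic (mppMatrix G t) :=
  stepMatrix_colStochastic _ _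

/-- The masses at time `k` are determined by the graphs before time `k`. -/
lemma mppY_congr {G G' : ℕ → LoopDigraph n} {k : ℕ} (h : ∀ s < k, G s = G' s) :
    mppY G k = mppY G' k := by
  induction k with
  | zero => rfl
  | succ k ih =>
    rw [mppY_succ, mppY_succ, mppMatrix_eq, mppMatrix_eq, ih fun s hs => h s (by omega),
      h k (by omega)]

lemma delta_pos (hn : 2 ≤ n) : 0 < delta n := by unfold delta; positivity

lemma delta_le_one (hn : 2 ≤ n) : delta n ≤ 1 := by
  rw [delta, div_le_one (by positivity)]
  exact one_le_pow₀ (by exact_mod_cast (by omega : 1 ≤ n))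

/-- A node below the threshold keeps its whole mass, and a node above it keeps at least the
fraction `1 / n`, so masses never fall below `δ / n`. -/
lemma le_mppY (hn : 2 ≤ n) (G : ℕ → LoopDigraph n) (k : ℕ) (i : Fin n) :
    delta n / n ≤ mppY G k i := by
  have hδ := delta_pos hn
  have h1 : (1 : ℝ) ≤ n := by exact_mod_cast (by omega : 1 ≤ n)
  have hn0 : (0 : ℝ) < n := by linarith
  induction k generalizing i with
  | zero => exact (div_le_self hδ.le h1).trans (delta_le_one hn)
  | succ k ih =>
    have h0 : ∀ i, 0 ≤ mppY G k i := fun i => le_trans (by positivity) (ih i)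
    rw [mppY_succ]
    refine le_trans ?_ (mul_le_mulVec (mppMatrix_colStochastic G k).nonneg h0 i i)
    rcases lt_or_ge (mppY G k i) (delta n) with h | h
    · rw [mppMatrix_eq, stepMatrix_self_of_lt h, one_mul]
      exact ih i
    · rw [div_eq_inv_mul]
      exact mul_le_mul (inv_le_stepMatrix_self _ _ i) h hδ.le
        ((mppMatrix_colStochastic G k).nonneg _ _)

lemma mppY_pos (hn : 2 ≤ n) (G : ℕ → LoopDigraph n) (k : ℕ) (i : Fin n) : 0 < mppY G k i :=
  lt_of_lt_of_le (div_pos (delta_pos hn) (by positivity)) (le_mppY hn G k i)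

lemma sum_mppY (G : ℕ → LoopDigraph n) (k : ℕ) : ∑ i, mppY G k i = n := by
  induction k with
  | zero => simp [mppY]
  | succ k ih => rw [mppY_succ, (mppMatrix_colStochastic G k).sum_mulVec, ih]

/-- The list of graphs available at the times `k, …, k + m - 1`. -/
def window (G : ℕ → LoopDigraph n) (k m : ℕ) : List (LoopDigraph n) :=
  (List.range m).map fun j => G (k + j)

lemma window_succ (G : ℕ → LoopDigraph n) (k m : ℕ) :
    window G k (m + 1) = window G k m ++ [G (k + m)] := by
  simp [window, List.range_succ]

lemma mppY_add (G : ℕ → LoopDigraph n) (k m : ℕ) :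
    mppY G (k + m) = runMass (window G k m) (mppY G k) := by
  induction m with
  | zero => rfl
  | succ m ih =>
    rw [window_succ, runMass_append, ← ih]
    rfl

/-! ### The disagreement vector -/

/-- The disagreement vector `x k - x̄ k • y k`, whose entries sum to zero. -/
noncomputable def disagreement (G : ℕ → LoopDigraph n) (x₀ : Fin n → ℝ) (ε : ℕ → Fin n → ℝ)
    (k : ℕ) : Fin n → ℝ :=
  mppX G x₀ ε k - mppAvg G x₀ ε k • mppY G k

lemma sum_disagreement (hn : 2 ≤ n) (G : ℕ → LoopDigraph n) (x₀ : Fin n → ℝ)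
    (ε : ℕ → Fin n → ℝ) (k : ℕ) : ∑ i, disagreement G x₀ ε k i = 0 := by
  have hn0 : (n : ℝ) ≠ 0 := by positivity
  simp only [disagreement, Pi.sub_apply, Pi.smul_apply, smul_eq_mul, Finset.sum_sub_distrib,
    ← Finset.mul_sum, sum_mppY, mppAvg]
  field_simp
  ring

lemma mppAvg_succ (G : ℕ → LoopDigraph n) (x₀ : Fin n → ℝ) (ε : ℕ → Fin n → ℝ) (k : ℕ) :
    mppAvg G x₀ ε (k + 1) = mppAvg G x₀ ε k + (∑ i, ε (k + 1) i) / n := by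
  simp only [mppAvg, mppX, Pi.add_apply, Finset.sum_add_distrib,
    (mppMatrix_colStochastic G k).sum_mulVec, add_div]

lemma disagreement_succ (G : ℕ → LoopDigraph n) (x₀ : Fin n → ℝ) (ε : ℕ → Fin n → ℝ) (k : ℕ) :
    disagreement G x₀ ε (k + 1) = (mppMatrix G k).mulVec (disagreement G x₀ ε k) +
      (ε (k + 1) - ((∑ i, ε (k + 1) i) / n) • mppY G (k + 1)) := by
  rw [disagreement, disagreement, mppAvg_succ, Matrix.mulVec_sub, Matrix.mulVec_smul, ← mppY_succ,
    mppX, add_smul]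
  abel

/-- Removing the mean component along a nonnegative vector of total mass `n` at most doubles the
`1`-norm. -/
lemma norm1_sub_mean_smul_le (hn : 2 ≤ n) (e : Fin n → ℝ) {y : Fin n → ℝ} (hy : ∀ i, 0 ≤ y i)
    (hys : ∑ i, y i = n) : norm1 (e - ((∑ i, e i) / n) • y) ≤ 2 * norm1 e := by
  have hn0 : (0 : ℝ) < n := by positivity
  rw [sub_eq_add_neg]
  refine (norm1_add_le _ _).trans ?_
  have : norm1 (-(((∑ i, e i) / n) • y)) = |∑ i, e i| := by
    simp only [norm1, Pi.neg_apply, Pi.smul_apply, smul_eq_mul, abs_neg, abs_mul,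
      abs_of_nonneg (hy _), ← Finset.mul_sum, hys, abs_div, abs_of_pos hn0]
    field_simp
  rw [this]
  linarith [abs_sum_le_norm1 e]

lemma norm1_disagreement_zero_le (hn : 2 ≤ n) (G : ℕ → LoopDigraph n) (x₀ : Fin n → ℝ)
    (ε : ℕ → Fin n → ℝ) : norm1 (disagreement G x₀ ε 0) ≤ 2 * norm1 x₀ :=
  norm1_sub_mean_smul_le hn x₀ (fun i => (mppY_pos hn G 0 i).le) (sum_mppY G 0)

/-- Over `m` steps the disagreement follows the product of the weight matrices, up to twice the
total perturbation. -/
lemma norm1_disagreement_sub_le (hn : 2 ≤ n) (G : ℕ → LoopDigraph n) (x₀ : Fin n → ℝ)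
    (ε : ℕ → Fin n → ℝ) (k m : ℕ) :
    norm1 (disagreement G x₀ ε (k + m) -
        (runMatrix (window G k m) (mppY G k)).mulVec (disagreement G x₀ ε k)) ≤
      2 * ∑ j ∈ Finset.range m, norm1 (ε (k + j + 1)) := by
  induction m with
  | zero => simp [window, runMatrix, norm1]
  | succ m ih =>
    have hrun : runMatrix (window G k (m + 1)) (mppY G k) =
        mppMatrix G (k + m) * runMatrix (window G k m) (mppY G k) := by
      rw [window_succ, runMatrix_append, ← mppY_add, mppMatrix_eq]
      simp [runMatrix]
    have hsplit : disagreement G x₀ ε (k + (m + 1)) -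
        (runMatrix (window G k (m + 1)) (mppY G k)).mulVec (disagreement G x₀ ε k) =
        (mppMatrix G (k + m)).mulVec (disagreement G x₀ ε (k + m) -
          (runMatrix (window G k m) (mppY G k)).mulVec (disagreement G x₀ ε k)) +
        (ε (k + m + 1) - ((∑ i, ε (k + m + 1) i) / n) • mppY G (k + m + 1)) := by
      rw [← add_assoc, disagreement_succ, hrun, Matrix.mulVec_sub, Matrix.mulVec_mulVec]
      abel
    rw [hsplit, Finset.sum_range_succ, mul_add]
    refine (norm1_add_le _ _).trans (add_le_add ?_ ?_)
    · exact ((mppMatrix_colStochastic G _).norm1_mulVec_le _).trans ih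
    · exact norm1_sub_mean_smul_le hn _ (fun i => (mppY_pos hn G _ i).le) (sum_mppY G _)

lemma abs_mppZ_sub_mppAvg_le (hn : 2 ≤ n) (G : ℕ → LoopDigraph n) (x₀ : Fin n → ℝ)
    (ε : ℕ → Fin n → ℝ) (k : ℕ) (i : Fin n) :
    |mppZ G x₀ ε (k + 1) i - mppAvg G x₀ ε k| ≤ n / delta n * norm1 (disagreement G x₀ ε k) := by
  have hy := mppY_pos hn G (k + 1) i
  have hδ := delta_pos hn
  have hn0 : (0 : ℝ) < n := by positivity
  have h : mppZ G x₀ ε (k + 1) i - mppAvg G x₀ ε k =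
      (mppY G (k + 1) i)⁻¹ * (mppMatrix G k).mulVec (disagreement G x₀ ε k) i := by
    rw [disagreement, Matrix.mulVec_sub, Matrix.mulVec_smul, ← mppY_succ, mppZ, mppW]
    simp only [Pi.sub_apply, Pi.smul_apply, smul_eq_mul]
    field_simp
  rw [h, abs_mul, abs_of_pos (inv_pos.2 hy)]
  refine mul_le_mul ?_ ((abs_le_norm1 _ i).trans
    ((mppMatrix_colStochastic G k).norm1_mulVec_le _)) (abs_nonneg _) (by positivity)
  rw [← inv_div]
  exact inv_anti₀ (by positivity) (le_mppY hn G (k + 1) i)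

/-! ### A scalar majorant that depends on the graphs only -/

/-- The choice `σ` of a window for each mass vector is realized from time `k` on. -/
def Favourable (σ : (Fin n → ℝ) → ℕ → LoopDigraph n) (G : ℕ → LoopDigraph n) (k : ℕ) : Prop :=
  ∀ j < windowLength n, G (k + j) = σ (mppY G k) j

open Classical in
/-- A bound for the `1`-norm of the disagreement at time `k`, for initial vectors of norm at most
`X` and perturbations `ε (s + 1)` of norm at most `e s`. Windows of length `2 n - 2` contract it
when they are favourable. Unlike the disagreement itself it is a function of the graphs before time
`k` only, which makes it independent of the next window although the perturbations need not be. -/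
noncomputable def majorant (σ : (Fin n → ℝ) → ℕ → LoopDigraph n) (X : ℝ) (e : ℕ → ℝ)
    (G : ℕ → LoopDigraph n) (k : ℕ) : ℝ :=
  if h : 0 < windowLength n ∧ windowLength n ≤ k then
    (1 - gain n * if Favourable σ G (k - windowLength n) then 1 else 0) *
        majorant σ X e G (k - windowLength n) +
      2 * ∑ j ∈ Finset.range (windowLength n), e (k - windowLength n + j)
  else 2 * X + 2 * ∑ j ∈ Finset.range k, e j
termination_by k
decreasing_by omega

lemma majorant_of_lt (σ : (Fin n → ℝ) → ℕ → LoopDigraph n) (X : ℝ) (e : ℕ → ℝ)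
    (G : ℕ → LoopDigraph n) {k : ℕ} (hk : k < windowLength n) :
    majorant σ X e G k = 2 * X + 2 * ∑ j ∈ Finset.range k, e j := by
  rw [majorant, dif_neg (by omega)]

lemma windowLength_pos (hn : 2 ≤ n) : 0 < windowLength n := by
  unfold windowLength; omega

open Classical in
lemma majorant_add (hn : 2 ≤ n) (σ : (Fin n → ℝ) → ℕ → LoopDigraph n) (X : ℝ) (e : ℕ → ℝ)
    (G : ℕ → LoopDigraph n) (k : ℕ) :
    majorant σ X e G (k + windowLength n) =
      (1 - gain n * if Favourable σ G k then 1 else 0) * majorant σ X e G k +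
        2 * ∑ j ∈ Finset.range (windowLength n), e (k + j) := by
  rw [majorant, dif_pos ⟨windowLength_pos hn, by omega⟩, Nat.add_sub_cancel]

lemma windowLength_induction (hn : 2 ≤ n) {P : ℕ → Prop} (h0 : ∀ k < windowLength n, P k)
    (h1 : ∀ k, P k → P (k + windowLength n)) (k : ℕ) : P k := by
  induction k using Nat.strong_induction_on with
  | _ k ih =>
    rcases lt_or_ge k (windowLength n) with h | h
    · exact h0 k h
    · have := h1 _ (ih (k - windowLength n) (by have := windowLength_pos hn; omega))
      rwa [Nat.sub_add_cancel h] at this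

lemma gain_pos (hn : 2 ≤ n) : 0 < gain n := by unfold gain; positivity

lemma gain_le_one (hn : 2 ≤ n) : gain n ≤ 1 :=
  inv_le_one_of_one_le₀ (one_le_pow₀ (by exact_mod_cast (by omega : 1 ≤ n)))

lemma majorant_nonneg (hn : 2 ≤ n) (σ : (Fin n → ℝ) → ℕ → LoopDigraph n) {X : ℝ} {e : ℕ → ℝ}
    (hX : 0 ≤ X) (he : ∀ s, 0 ≤ e s) (G : ℕ → LoopDigraph n) (k : ℕ) :
    0 ≤ majorant σ X e G k := by
  induction k using windowLength_induction hn with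
  | h0 k hk =>
    rw [majorant_of_lt σ X e G hk]
    have := Finset.sum_nonneg (s := Finset.range k) fun s _ => he s
    positivity
  | h1 k ih =>
    rw [majorant_add hn]
    have := Finset.sum_nonneg (s := Finset.range (windowLength n)) fun j _ => he (k + j)
    have hg := gain_le_one hn
    have : 0 ≤ 1 - gain n := by linarith
    split_ifs
    · rw [mul_one]; positivity
    · rw [mul_zero, sub_zero, one_mul]; positivity

lemma favourable_congr {σ : (Fin n → ℝ) → ℕ → LoopDigraph n} {G G' : ℕ → LoopDigraph n} {k : ℕ}
    (h : ∀ s < k + windowLength n, G s = G' s) : Favourable σ G k ↔ Favourable σ G' k := by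
  rw [Favourable, Favourable, mppY_congr fun s hs => h s (by omega)]
  exact forall₂_congr fun j hj => by rw [h _ (by omega)]

lemma majorant_congr (hn : 2 ≤ n) (σ : (Fin n → ℝ) → ℕ → LoopDigraph n) (X : ℝ) (e : ℕ → ℝ)
    {G G' : ℕ → LoopDigraph n} (k : ℕ) :
    (∀ s < k, G s = G' s) → majorant σ X e G k = majorant σ X e G' k := by
  induction k using windowLength_induction hn with
  | h0 k hk => exact fun _ => by rw [majorant_of_lt σ X e G hk, majorant_of_lt σ X e G' hk]
  | h1 k ih =>
    classical
    intro h
    rw [majorant_add hn, majorant_add hn, ih fun s hs => h s (by omega)]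
    rw [if_congr (favourable_congr (σ := σ) h) rfl rfl]

lemma norm1_disagreement_le_majorant (hn : 2 ≤ n) {σ : (Fin n → ℝ) → ℕ → LoopDigraph n}
    (hσ : ∀ y : Fin n → ℝ, (∀ i, 0 ≤ y i) → ∑ i, y i = n → ∀ v : Fin n → ℝ, ∑ i, v i = 0 →
      norm1 ((runMatrix ((List.range (windowLength n)).map (σ y)) y).mulVec v)
        ≤ (1 - gain n) * norm1 v)
    (G : ℕ → LoopDigraph n) (x₀ : Fin n → ℝ) {ε : ℕ → Fin n → ℝ} {e : ℕ → ℝ}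
    (he : ∀ s, norm1 (ε (s + 1)) ≤ e s) (k : ℕ) :
    norm1 (disagreement G x₀ ε k) ≤ majorant σ (norm1 x₀) e G k := by
  have hstep : ∀ k m, norm1 (disagreement G x₀ ε (k + m)) ≤
      norm1 ((runMatrix (window G k m) (mppY G k)).mulVec (disagreement G x₀ ε k)) +
        2 * ∑ j ∈ Finset.range m, e (k + j) := by
    intro k m
    have h1 := norm1_add_le
      ((runMatrix (window G k m) (mppY G k)).mulVec (disagreement G x₀ ε k))
      (disagreement G x₀ ε (k + m) -
        (runMatrix (window G k m) (mppY G k)).mulVec (disagreement G x₀ ε k))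
    rw [add_sub_cancel] at h1
    have h2 := norm1_disagreement_sub_le hn G x₀ ε k m
    have h3 := Finset.sum_le_sum (s := Finset.range m) fun j _ => he (k + j)
    linarith
  induction k using windowLength_induction hn with
  | h0 k hk =>
    rw [majorant_of_lt _ _ _ _ hk]
    have h1 := hstep 0 k
    have h2 := (runMatrix_colStochastic (window G 0 k) (mppY G 0)).norm1_mulVec_le
      (disagreement G x₀ ε 0)
    have h3 := norm1_disagreement_zero_le hn G x₀ ε
    simp only [zero_add] at h1
    linarith
  | h1 k ih =>
    rw [majorant_add hn]
    refine (hstep k _).trans (add_le_add_left ?_ _)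
    split_ifs with hF
    · rw [mul_one]
      have hw : window G k (windowLength n) =
          (List.range (windowLength n)).map (σ (mppY G k)) :=
        List.map_congr_left fun j hj => hF j (List.mem_range.1 hj)
      rw [hw]
      exact (hσ _ (fun i => (mppY_pos hn G k i).le) (sum_mppY G k) _
        (sum_disagreement hn G x₀ ε k)).trans
        (mul_le_mul_of_nonneg_left ih (by linarith [gain_le_one hn]))
    · rw [mul_zero, sub_zero, one_mul]
      exact ((runMatrix_colStochastic _ _).norm1_mulVec_le _).trans ih

/-! ### Functions of finitely many of the random graphs -/

instance : DiscreteMeasurableSpace (LoopDigraph n) := ⟨fun _ => trivial⟩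

instance : Nonempty (LoopDigraph n) := ⟨⟨⊤, fun _ => trivial⟩⟩

open Classical in
/-- A sequence of graphs prescribed before time `k`, continued arbitrarily. -/
noncomputable def extendHistory {k : ℕ} (h : Fin k → LoopDigraph n) (s : ℕ) : LoopDigraph n :=
  if hs : s < k then h ⟨s, hs⟩ else Classical.arbitrary _

lemma extendHistory_apply {k : ℕ} (G : ℕ → LoopDigraph n) {s : ℕ} (hs : s < k) :
    extendHistory (fun s : Fin k => G s) s = G s := by
  simp [extendHistory, hs]

variable {Ω : Type*} [MeasurableSpace Ω] {μ : Measure Ω} {G : ℕ → Ω → LoopDigraph n}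
  {prob : LoopDigraph n → ℝ}

/-- A function of the first `k` graphs takes its argument in a finite discrete space, so it is
measurable, bounded and integrable without any further hypothesis. -/
lemma measurable_of_history (hG : ∀ t, Measurable (G t)) {β : Type*} [MeasurableSpace β]
    {F : (ℕ → LoopDigraph n) → β} {k : ℕ}
    (hF : ∀ g g', (∀ s < k, g s = g' s) → F g = F g') : Measurable fun ω => F fun s => G s ω := by
  have h : (fun ω => F fun s => G s ω) =
      (fun h : Fin k → LoopDigraph n => F (extendHistory h)) ∘ fun ω (s : Fin k) => G s ω := by
    funext ω
    exact hF _ _ fun s hs => (extendHistory_apply (fun s => G s ω) hs).symm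
  rw [h]
  exact (Measurable.of_discrete).comp (measurable_pi_lambda _ fun s => hG s)

lemma exists_bound_of_history {F : (ℕ → LoopDigraph n) → ℝ} {k : ℕ}
    (hF : ∀ g g', (∀ s < k, g s = g' s) → F g = F g') : ∃ C, ∀ g, |F g| ≤ C := by
  obtain ⟨C, hC⟩ := (Set.finite_range
    fun h : Fin k → LoopDigraph n => |F (extendHistory h)|).bddAbove
  refine ⟨C, fun g => ?_⟩
  rw [hF g _ fun s hs => (extendHistory_apply g hs).symm]
  exact hC ⟨_, rfl⟩

lemma integrable_of_history [IsProbabilityMeasure μ] (hG : ∀ t, Measurable (G t))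
    {F : (ℕ → LoopDigraph n) → ℝ} {k : ℕ}
    (hF : ∀ g g', (∀ s < k, g s = g' s) → F g = F g') :
    Integrable (fun ω => F fun s => G s ω) μ := by
  obtain ⟨C, hC⟩ := exists_bound_of_history hF
  exact Integrable.of_bound (measurable_of_history hG hF).aestronglyMeasurable C
    (ae_of_all _ fun ω => hC _)

/-! ### The probability of a favourable window -/

lemma measurableSet_prefix (hG : ∀ t, Measurable (G t)) (g : ℕ → LoopDigraph n) (k : ℕ) :
    MeasurableSet {ω | ∀ s < k, G s ω = g s} := by
  have : {ω | ∀ s < k, G s ω = g s} = ⋂ s ∈ Finset.range k, G s ⁻¹' {g s} := by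
    ext; simp
  rw [this]
  exact Finset.measurableSet_biInter _ fun s _ => hG s (measurableSet_singleton _)

lemma measureReal_prefix (hG : RandomGraphAssumption μ G prob) (g : ℕ → LoopDigraph n) (k : ℕ) :
    μ.real {ω | ∀ s < k, G s ω = g s} = ∏ s ∈ Finset.range k, prob (g s) := by
  have : {ω | ∀ s < k, G s ω = g s} = ⋂ s ∈ Finset.range k, G s ⁻¹' {g s} := by
    ext; simp
  rw [this, Measure.real, hG.independent.measure_inter_preimage_eq_mul (Finset.range k)
    (fun s _ => measurableSet_singleton (g s)), ENNReal.toReal_prod]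
  exact Finset.prod_congr rfl fun s _ => hG.law s (g s)

lemma finite_prob_values (prob : LoopDigraph n → ℝ) :
    {r | 0 < r ∧ ∃ b, prob b = r}.Finite :=
  (Set.finite_range prob).subset fun _ hr => hr.2

lemma minProb_le {b : LoopDigraph n} (hb : 0 < prob b) : minProb prob ≤ prob b :=
  csInf_le (finite_prob_values prob).bddBelow ⟨hb, b, rfl⟩

lemma minProb_pos (h : ∃ b, 0 < prob b) : 0 < minProb prob := by
  obtain ⟨b, hb⟩ := h
  have : minProb prob ∈ {r | 0 < r ∧ ∃ b, prob b = r} :=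
    Set.Nonempty.csInf_mem ⟨prob b, hb, b, rfl⟩ (finite_prob_values prob)
  exact this.1

lemma minProb_le_one [IsProbabilityMeasure μ] (hG : RandomGraphAssumption μ G prob)
    (h : ∃ b, 0 < prob b) : minProb prob ≤ 1 := by
  obtain ⟨b, hb⟩ := h
  exact (minProb_le hb).trans (hG.law 0 b ▸ measureReal_le_one)

/-- By independence, fixing `m` further graphs costs at most one factor `minProb` for each. -/
lemma minProb_pow_mul_le_measureReal_prefix [IsProbabilityMeasure μ]
    (hG : RandomGraphAssumption μ G prob) (hprob : ∃ b, 0 < prob b) {k m : ℕ}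
    {g : ℕ → LoopDigraph n} (hg : ∀ j < m, 0 < prob (g (k + j))) :
    minProb prob ^ m * μ.real {ω | ∀ s < k, G s ω = g s} ≤
      μ.real {ω | ∀ s < k + m, G s ω = g s} := by
  rw [measureReal_prefix hG, measureReal_prefix hG, Finset.prod_range_add, mul_comm]
  have hnn : ∀ b, 0 ≤ prob b := fun b => hG.law 0 b ▸ measureReal_nonneg
  refine mul_le_mul_of_nonneg_left ?_ (Finset.prod_nonneg fun s _ => hnn _)
  have := Finset.prod_le_prod (s := Finset.range m) (f := fun _ => minProb prob)
    (g := fun j => prob (g (k + j))) (fun _ _ => (minProb_pos hprob).le)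
    (fun j hj => minProb_le (hg j (Finset.mem_range.1 hj)))
  simpa using this

open Classical in
/-- A window chosen as a function of the past is realized with conditional probability at least
`p`. This is stated for the expectation of a nonnegative function `F` of the past, and proved by
summing over the finitely many pasts. -/
lemma windowProb_mul_integral_le [IsProbabilityMeasure μ]
    (hG : RandomGraphAssumption μ G prob) (hprob : ∃ b, 0 < prob b)
    {σ : (Fin n → ℝ) → ℕ → LoopDigraph n} {k : ℕ}
    (hσ : ∀ g : ℕ → LoopDigraph n, ∀ j < windowLength n, 0 < prob (σ (mppY g k) j))
    {F : (ℕ → LoopDigraph n) → ℝ} (hF0 : ∀ g, 0 ≤ F g)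
    (hF : ∀ g g', (∀ s < k, g s = g' s) → F g = F g') :
    windowProb prob * ∫ ω, F (fun s => G s ω) ∂μ ≤
      ∫ ω, (if Favourable σ (fun s => G s ω) k then 1 else 0) * F (fun s => G s ω) ∂μ := by
  have : Fintype (Fin k → LoopDigraph n) := Fintype.ofFinite _
  -- the past `h`, followed by the window chosen for it
  let ext : (Fin k → LoopDigraph n) → ℕ → LoopDigraph n := fun h s =>
    if s < k then extendHistory h s else σ (mppY (extendHistory h) k) (s - k)
  have ext_lt : ∀ h s, s < k → ext h s = extendHistory h s := fun h s hs => if_pos hs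
  have ext_add : ∀ h j, ext h (k + j) = σ (mppY (extendHistory h) k) j := fun h j => by
    simp [ext]
  have hpast : ∀ g : ℕ → LoopDigraph n, ∀ h, (∀ s < k, g s = ext h s) ↔
      (fun s : Fin k => g s) = h := by
    intro g h
    constructor
    · intro H
      funext s
      rw [H s s.2, ext_lt h s s.2]
      simp [extendHistory]
    · rintro rfl s hs
      rw [ext_lt _ s hs, extendHistory_apply g hs]
  have hY : ∀ g : ℕ → LoopDigraph n, ∀ h, (∀ s < k, g s = ext h s) →
      mppY g k = mppY (extendHistory h) k := fun g h H =>
    mppY_congr fun s hs => (H s hs).trans (ext_lt h s hs)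
  have hfav : ∀ g : ℕ → LoopDigraph n, ∀ h, (∀ s < k + windowLength n, g s = ext h s) ↔
      (fun s : Fin k => g s) = h ∧ Favourable σ g k := by
    intro g h
    rw [← hpast]
    constructor
    · intro H
      have H' : ∀ s < k, g s = ext h s := fun s hs => H s (by omega)
      exact ⟨H', fun j hj => by rw [H _ (by omega), ext_add, hY g h H']⟩
    · rintro ⟨H, H'⟩ s hs
      rcases lt_or_ge s k with h1 | h1
      · exact H s h1
      · obtain ⟨j, rfl⟩ := Nat.exists_eq_add_of_le h1
        rw [ext_add, H' j (by omega), hY g h H]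
  have hsum : ∀ (g : ℕ → LoopDigraph n) (c : Prop) [Decidable c]
      (Q : (Fin k → LoopDigraph n) → Prop) [DecidablePred Q],
      (∀ h, Q h ↔ (fun s : Fin k => g s) = h ∧ c) →
      (if c then 1 else 0) * F g = ∑ h, F (ext h) * if Q h then 1 else 0 := by
    intro g c _ Q _ hQ
    rw [Finset.sum_eq_single (fun s : Fin k => g s)]
    · rw [hF g _ ((hpast g _).2 rfl), mul_comm, if_congr ((hQ _).trans (and_iff_right rfl)) rfl rfl]
    · intro h _ hh
      rw [if_neg fun H => hh ((hQ h).1 H).1.symm, mul_zero]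
    · simp
  have hind : ∀ (g : ℕ → LoopDigraph n) (m : ℕ),
      (fun ω => if ∀ s < m, G s ω = g s then (1 : ℝ) else 0) =
        {ω | ∀ s < m, G s ω = g s}.indicator 1 := by
    intro g m
    funext ω
    simp [Set.indicator_apply]
  have hint : ∀ (g : ℕ → LoopDigraph n) (m : ℕ),
      Integrable (fun ω => if ∀ s < m, G s ω = g s then (1 : ℝ) else 0) μ ∧
      ∫ ω, (if ∀ s < m, G s ω = g s then (1 : ℝ) else 0) ∂μ =
        μ.real {ω | ∀ s < m, G s ω = g s} := by
    intro g m
    have hm := measurableSet_prefix hG.measurable g m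
    rw [hind, integral_indicator_one hm]
    exact ⟨(integrable_const (1 : ℝ)).indicator hm, rfl⟩
  have h1 : ∫ ω, F (fun s => G s ω) ∂μ = ∑ h : Fin k → LoopDigraph n,
      F (ext h) * μ.real {ω | ∀ s < k, G s ω = ext h s} := by
    calc _ = ∫ ω, ∑ h : Fin k → LoopDigraph n,
          F (ext h) * (if ∀ s < k, G s ω = ext h s then 1 else 0) ∂μ := by
          congr with ω
          rw [← hsum (fun s => G s ω) True _ fun h => by rw [hpast, and_true], if_pos trivial,
            one_mul]
      _ = _ := by
          rw [integral_finsetSum _ fun h _ => (hint _ _).1.const_mul _]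
          exact Finset.sum_congr rfl fun h _ => by rw [integral_const_mul, (hint _ _).2]
  have h2 : ∫ ω, (if Favourable σ (fun s => G s ω) k then 1 else 0) * F (fun s => G s ω) ∂μ =
      ∑ h : Fin k → LoopDigraph n,
        F (ext h) * μ.real {ω | ∀ s < k + windowLength n, G s ω = ext h s} := by
    calc _ = ∫ ω, ∑ h : Fin k → LoopDigraph n,
          F (ext h) * (if ∀ s < k + windowLength n, G s ω = ext h s then 1 else 0) ∂μ := by
          congr with ω
          exact hsum (fun s => G s ω) _ _ fun h => hfav _ h
      _ = _ := by
          rw [integral_finsetSum _ fun h _ => (hint _ _).1.const_mul _]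
          exact Finset.sum_congr rfl fun h _ => by rw [integral_const_mul, (hint _ _).2]
  rw [h1, h2, Finset.mul_sum]
  refine Finset.sum_le_sum fun h _ => ?_
  rw [mul_left_comm]
  refine mul_le_mul_of_nonneg_left (minProb_pow_mul_le_measureReal_prefix hG hprob fun j hj => ?_)
    (hF0 _)
  rw [ext_add]
  exact hσ _ j hj

/-! ### Expectation of the majorant -/

/-- In expectation the majorant contracts by `1 - η p` per window, up to the noise. -/
lemma integral_majorant_add_le [IsProbabilityMeasure μ] (hn : 2 ≤ n)
    (hG : RandomGraphAssumption μ G prob) (hprob : ∃ b, 0 < prob b)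
    {σ : (Fin n → ℝ) → ℕ → LoopDigraph n}
    (hσ : ∀ (g : ℕ → LoopDigraph n) (k : ℕ), ∀ j < windowLength n, 0 < prob (σ (mppY g k) j))
    {X : ℝ} (hX : 0 ≤ X) {e : ℕ → ℝ} (he : ∀ s, 0 ≤ e s) (k : ℕ) :
    ∫ ω, majorant σ X e (fun s => G s ω) (k + windowLength n) ∂μ ≤
      (1 - gain n * windowProb prob) * ∫ ω, majorant σ X e (fun s => G s ω) k ∂μ +
        2 * ∑ j ∈ Finset.range (windowLength n), e (k + j) := by
  classical
  have hdep : ∀ g g' : ℕ → LoopDigraph n, (∀ s < k, g s = g' s) →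
      majorant σ X e g k = majorant σ X e g' k := fun g g' => majorant_congr hn σ X e k
  have hI := integrable_of_history (μ := μ) hG.measurable hdep
  have hI' : Integrable (fun ω => (if Favourable σ (fun s => G s ω) k then (1 : ℝ) else 0) *
      majorant σ X e (fun s => G s ω) k) μ := by
    refine integrable_of_history (k := k + windowLength n) (F := fun g =>
      (if Favourable σ g k then (1 : ℝ) else 0) * majorant σ X e g k) hG.measurable
      fun g g' h => ?_
    rw [hdep g g' fun s hs => h s (by omega), if_congr (favourable_congr (σ := σ) h) rfl rfl]
  have hmain := windowProb_mul_integral_le hG hprob (fun g => hσ g k)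
    (fun g => majorant_nonneg hn σ hX he g k) hdep
  have hrew : ∀ ω, majorant σ X e (fun s => G s ω) (k + windowLength n) =
      (majorant σ X e (fun s => G s ω) k - gain n *
        ((if Favourable σ (fun s => G s ω) k then (1 : ℝ) else 0) *
          majorant σ X e (fun s => G s ω) k)) +
      2 * ∑ j ∈ Finset.range (windowLength n), e (k + j) := by
    intro ω
    rw [majorant_add hn]
    ring
  have hsub := hI.sub (hI'.const_mul (gain n))
  simp only [Pi.sub_def] at hsub
  simp_rw [hrew]
  rw [integral_add hsub (integrable_const _), integral_sub hI (hI'.const_mul _),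
    integral_const_mul, integral_const]
  simp only [probReal_univ, one_smul]
  have := mul_le_mul_of_nonneg_left hmain (gain_pos hn).le
  linarith

/-! ### Step sizes -/

lemma stepSize_pos (γ : ℝ) (k : ℕ) : 0 < stepSize γ (k + 1) := by
  unfold stepSize; positivity

lemma stepSize_anti {γ : ℝ} (hγ : 0 ≤ γ) {j k : ℕ} (h : j ≤ k) :
    stepSize γ (k + 1) ≤ stepSize γ (j + 1) := by
  unfold stepSize
  gcongr

lemma stepSize_le_one {γ : ℝ} (hγ : 0 ≤ γ) (k : ℕ) : stepSize γ (k + 1) ≤ 1 := by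
  simpa [stepSize] using stepSize_anti hγ (Nat.zero_le k)

lemma antitoneOn_rpow_neg {s a b : ℝ} (hs : 0 ≤ s) (ha : 0 < a) :
    AntitoneOn (fun x : ℝ => x ^ (-s)) (Set.Icc a b) := fun x hx y _ hxy =>
  Real.rpow_le_rpow_of_nonpos (ha.trans_le hx.1) hxy (by linarith)

/-- Comparison with `∫ s ^ (-2γ)` over `[1, ∞)`. -/
lemma sum_stepSize_sq_le {γ : ℝ} (hγ : 1 / 2 < γ) (T : ℕ) :
    ∑ k ∈ Finset.range T, stepSize γ (k + 1) ^ 2 ≤ 1 + 1 / (2 * γ - 1) := by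
  have hpos : 0 < 1 / (2 * γ - 1) := by
    apply one_div_pos.2; linarith
  cases T with
  | zero => rw [Finset.sum_range_zero]; linarith
  | succ T =>
    rw [Finset.sum_range_succ']
    have h1 : stepSize γ (0 + 1) ^ 2 = 1 := by simp [stepSize]
    have hsq : ∀ k : ℕ, stepSize γ (k + 1 + 1) ^ 2 =
        (fun x : ℝ => x ^ (-(2 * γ))) (1 + ((k + 1 : ℕ) : ℝ)) := by
      intro k
      have : (0 : ℝ) ≤ 1 + ((k + 1 : ℕ) : ℝ) := by positivity
      simp only [stepSize]
      rw [div_pow, one_pow, one_div, Real.rpow_neg this, mul_comm 2 γ, Real.rpow_mul this,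
        Real.rpow_two]
      push_cast
      rw [add_comm (1 : ℝ)]
    have hint := AntitoneOn.sum_le_integral (f := fun x : ℝ => x ^ (-(2 * γ))) (x₀ := 1) (a := T)
      (antitoneOn_rpow_neg (by linarith) one_pos)
    rw [integral_rpow (Or.inr ⟨by linarith, by
      rw [Set.uIcc_of_le (by linarith [(Nat.cast_nonneg T : (0 : ℝ) ≤ T)])]
      intro h; linarith [h.1]⟩)] at hint
    rw [h1, Finset.sum_congr rfl fun k _ => hsq k, add_comm]
    refine add_le_add le_rfl (hint.trans ?_)
    rw [Real.one_rpow, ← neg_div_neg_eq, neg_sub, show -(-(2 * γ) + 1) = 2 * γ - 1 by ring]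
    refine div_le_div_of_nonneg_right ?_ (by linarith)
    have : 0 ≤ (1 + (T : ℝ)) ^ (-(2 * γ) + 1) := by positivity
    linarith

/-- Comparison with `∫ s ^ (-γ)` over `[1, t + 2]`. -/
lemma one_div_sum_stepSize_le {γ : ℝ} (hγ : 0 ≤ γ) (hγ' : γ < 1) (t : ℕ) :
    1 / ∑ k ∈ Finset.range (t + 1), stepSize γ (k + 1) ≤ rate γ t := by
  have hint := AntitoneOn.integral_le_sum (f := fun x : ℝ => x ^ (-γ)) (x₀ := 1) (a := t + 1)
    (antitoneOn_rpow_neg hγ one_pos)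
  rw [integral_rpow (Or.inl (by linarith)), Real.one_rpow] at hint
  have hsum : ∑ k ∈ Finset.range (t + 1), (fun x : ℝ => x ^ (-γ)) (1 + (k : ℝ)) =
      ∑ k ∈ Finset.range (t + 1), stepSize γ (k + 1) := by
    refine Finset.sum_congr rfl fun k _ => ?_
    simp only [stepSize]
    rw [Real.rpow_neg (by positivity), one_div]
    push_cast
    rw [add_comm (1 : ℝ)]
  rw [hsum] at hint
  have h2 : (1 : ℝ) + ((t + 1 : ℕ) : ℝ) = t + 2 := by push_cast; ring
  rw [h2, show -γ + 1 = 1 - γ by ring] at hint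
  rw [rate, one_div, ← inv_div (((t : ℝ) + 2) ^ (1 - γ) - 1)]
  refine inv_anti₀ (div_pos (sub_pos.2 ?_) (by linarith)) hint
  exact Real.one_lt_rpow (by linarith [(Nat.cast_nonneg t : (0 : ℝ) ≤ t)]) (by linarith)

/-! ### Weighted sums of a sequence that contracts over windows -/

/-- Summing a recursion `a (k + B) ≤ (1 - c) a k + …` against decreasing weights absorbs the
contracted part of the sum into the sum itself. -/
lemma mul_sum_stepSize_mul_le {γ : ℝ} (hγ : 1 / 2 < γ) {B : ℕ} {c X U : ℝ} (hc1 : c ≤ 1)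
    (hX : 0 ≤ X) (hU : 0 ≤ U) {a : ℕ → ℝ} (ha : ∀ k, 0 ≤ a k)
    (ha0 : ∀ k < B, a k ≤ 2 * X + 2 * ∑ j ∈ Finset.range k, U * stepSize γ (j + 1))
    (haB : ∀ k, a (k + B) ≤ (1 - c) * a k +
      2 * ∑ j ∈ Finset.range B, U * stepSize γ (k + j + 1)) (T : ℕ) :
    c * ∑ k ∈ Finset.range T, stepSize γ (k + 1) * a k ≤
      4 * B * (X + U * (1 + 1 / (2 * γ - 1))) := by
  have hγ0 : 0 ≤ γ := by linarith
  set Z := 1 + 1 / (2 * γ - 1) with hZ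
  have hZ0 : 0 ≤ Z := by
    have : 0 < 1 / (2 * γ - 1) := by apply one_div_pos.2; linarith
    linarith
  have hα := stepSize_pos γ
  set α : ℕ → ℝ := fun k => stepSize γ (k + 1) with hαdef
  have hanti : ∀ {j k}, j ≤ k → α k ≤ α j := fun h => stepSize_anti hγ0 h
  -- the terms of the first window
  have hinit : ∑ k ∈ Finset.range B, α k * a k ≤ B * (2 * X + 2 * U * Z) := by
    have : ∀ k ∈ Finset.range B, α k * a k ≤ 2 * X + 2 * U * Z := by
      intro k hk
      calc α k * a k ≤ α k * (2 * X + 2 * ∑ j ∈ Finset.range k, U * α j) :=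
            mul_le_mul_of_nonneg_left (ha0 k (Finset.mem_range.1 hk)) (hα k).le
        _ = α k * (2 * X) + 2 * U * ∑ j ∈ Finset.range k, α k * α j := by
            rw [← Finset.mul_sum, ← Finset.mul_sum]; ring
        _ ≤ 2 * X + 2 * U * Z := by
            refine add_le_add ?_ ?_
            · exact mul_le_of_le_one_left (by positivity) (stepSize_le_one hγ0 k)
            · refine mul_le_mul_of_nonneg_left ?_ (by positivity)
              refine le_trans (Finset.sum_le_sum fun j hj => ?_) (sum_stepSize_sq_le hγ k)
              rw [sq]
              exact mul_le_mul_of_nonneg_right (hanti (Finset.mem_range.1 hj).le) (hα j).le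
    simpa [mul_add] using Finset.sum_le_sum this
  -- the weight `α (k + B)` is below the size `α (k + j)` of every perturbation in the window
  have hnoise : ∑ k ∈ Finset.range T, ∑ j ∈ Finset.range B, α (k + B) * α (k + j) ≤ B * Z := by
    rw [Finset.sum_comm]
    have : ∀ j ∈ Finset.range B, ∑ k ∈ Finset.range T, α (k + B) * α (k + j) ≤ Z := by
      intro j hj
      refine le_trans (Finset.sum_le_sum fun k _ => ?_) (sum_stepSize_sq_le hγ T)
      rw [sq]
      exact mul_le_mul (hanti (by omega)) (hanti (by omega)) (hα _).le (hα _).le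
    simpa using Finset.sum_le_sum this
  have hshift : ∑ k ∈ Finset.range T, α k * a k ≤
      ∑ k ∈ Finset.range B, α k * a k + ∑ k ∈ Finset.range T, α (k + B) * a (k + B) := by
    calc _ ≤ ∑ k ∈ Finset.range (B + T), α k * a k :=
          Finset.sum_le_sum_of_subset_of_nonneg (Finset.range_mono (by omega))
            fun k _ _ => mul_nonneg (hα k).le (ha k)
      _ = _ := by
          rw [Finset.sum_range_add]
          simp only [add_comm B]
  have hrec : ∑ k ∈ Finset.range T, α (k + B) * a (k + B) ≤
      (1 - c) * ∑ k ∈ Finset.range T, α k * a k + 2 * U * (B * Z) := by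
    calc _ ≤ ∑ k ∈ Finset.range T, ((1 - c) * (α k * a k) +
            2 * U * ∑ j ∈ Finset.range B, α (k + B) * α (k + j)) := by
          refine Finset.sum_le_sum fun k _ => ?_
          refine (mul_le_mul_of_nonneg_left (haB k) (hα _).le).trans ?_
          rw [mul_add]
          refine add_le_add ?_ (le_of_eq ?_)
          · rw [mul_left_comm]
            exact mul_le_mul_of_nonneg_left
              (mul_le_mul_of_nonneg_right (hanti (by omega)) (ha k)) (by linarith)
          · rw [← Finset.mul_sum, ← Finset.mul_sum]; ring
      _ ≤ _ := by
          rw [Finset.sum_add_distrib, ← Finset.mul_sum, ← Finset.mul_sum]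
          gcongr
  have hXB : 0 ≤ (B : ℝ) * X := by positivity
  change c * ∑ k ∈ Finset.range T, α k * a k ≤ _
  nlinarith

/-! ### The constant `λ` -/

/-- The true contraction rate is far better than `λ`: since `1 - (1 - h) ^ r ≤ h` for `r ≤ 1`, the
gap `1 - λ` is at most `n ^ (-4 n B / p)`. -/
lemma lam_bounds (hn : 2 ≤ n) {prob : LoopDigraph n → ℝ} (hp0 : 0 < windowProb prob)
    (hp1 : windowProb prob ≤ 1) :
    lam prob < 1 ∧
      (1 - lam prob) * (4 * n * windowLength n) ≤ 30 * (gain n * windowProb prob) := by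
  set p := windowProb prob
  have hn2 : (2 : ℝ) ≤ n := by exact_mod_cast hn
  have hn0 : (0 : ℝ) < n := by linarith
  have hB1 : (1 : ℝ) ≤ windowLength n := by exact_mod_cast windowLength_pos hn
  have hB : 2 * (n : ℝ) - 2 = windowLength n := by
    rw [windowLength, Nat.cast_sub (by omega)]; push_cast; ring
  set m : ℝ := 4 * n * windowLength n / p with hm
  have hmp : m * p = 4 * n * windowLength n := div_mul_cancel₀ _ hp0.ne'
  have hm4 : 4 * n * (windowLength n : ℝ) ≤ m := by
    rw [hm, le_div_iff₀ hp0]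
    exact mul_le_of_le_one_right (by positivity) hp1
  have hm2 : 2 * ((n : ℝ) - 1) ≤ m ∧ 2 ≤ m := by
    constructor <;> nlinarith
  set N : ℝ := (n : ℝ) ^ m with hN
  have hN1 : 1 < N := Real.one_lt_rpow (by linarith) (by linarith)
  have hN0 : 0 < N := by linarith
  have hlam : lam prob = (1 - 1 / N) ^ (p / (2 * n * windowLength n)) := rfl
  have hr0 : 0 < p / (2 * n * windowLength n) := by positivity
  have hr1 : p / (2 * n * windowLength n) ≤ 1 := by
    rw [div_le_one (by positivity)]; nlinarith
  have hh0 : 0 < 1 - 1 / N := sub_pos.2 ((div_lt_one hN0).2 hN1)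
  have hh1 : 1 - 1 / N < 1 := by linarith [one_div_pos.2 hN0]
  refine ⟨hlam ▸ Real.rpow_lt_one hh0.le hh1 hr0, ?_⟩
  have hgap : 1 - lam prob ≤ 1 / N := by
    have := Real.rpow_le_rpow_of_exponent_ge hh0 hh1.le hr1
    rw [Real.rpow_one] at this
    rw [hlam]; linarith
  -- split `n ^ m` into two halves, one beating `m` and the other beating `n ^ (n - 1)`
  have hbig : m * (n : ℝ) ^ (n - 1) ≤ 30 * N := by
    have h1 : N = (n : ℝ) ^ (m / 2) * (n : ℝ) ^ (m / 2) := by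
      rw [hN, ← Real.rpow_add hn0, add_halves]
    have h2 : m / 2 ≤ (n : ℝ) ^ (m / 2) := by
      have hb := one_add_mul_self_le_rpow_one_add (s := 1) (by norm_num) (p := m / 2)
        (by linarith)
      have hc := Real.rpow_le_rpow (x := 1 + 1) (y := n) (z := m / 2) (by norm_num)
        (by linarith) (by linarith)
      linarith
    have h3 : (n : ℝ) ^ (n - 1) ≤ (n : ℝ) ^ (m / 2) := by
      rw [← Real.rpow_natCast]
      refine Real.rpow_le_rpow_of_exponent_le (by linarith) ?_
      rw [Nat.cast_sub (by omega)]
      push_cast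
      linarith [hm2.1]
    have h4 := mul_le_mul h2 h3 (by positivity) (by positivity)
    rw [← h1] at h4
    linarith
  calc (1 - lam prob) * (4 * n * windowLength n) ≤ 1 / N * (m * p) := by
        rw [hmp]
        exact mul_le_mul_of_nonneg_right hgap (by positivity)
    _ ≤ 30 * (gain n * p) := by
        rw [gain, one_div, inv_mul_le_iff₀ hN0, ← mul_assoc, ← mul_assoc]
        refine mul_le_mul_of_nonneg_right ?_ hp0.le
        rw [← div_eq_mul_inv, le_div_iff₀ (by positivity)]
        linarith

/-! ### Measurability of the algorithm -/

lemma measurable_mppY (hG : ∀ t, Measurable (G t)) (t : ℕ) (i : Fin n) :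
    Measurable fun ω => mppY (fun s => G s ω) t i :=
  measurable_of_history hG (F := fun g => mppY g t i) (k := t) fun _ _ h => by
    rw [mppY_congr h]

lemma measurable_mppMatrix (hG : ∀ t, Measurable (G t)) (t : ℕ) (i j : Fin n) :
    Measurable fun ω => mppMatrix (fun s => G s ω) t i j :=
  measurable_of_history hG (F := fun g => mppMatrix g t i j) (k := t + 1) fun g g' h => by
    rw [mppMatrix_eq, mppMatrix_eq, h t (by omega), mppY_congr fun s hs => h s (by omega)]

lemma measurable_mulVec {P : Ω → Matrix (Fin n) (Fin n) ℝ} {v : Ω → Fin n → ℝ}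
    (hP : ∀ i j, Measurable fun ω => P ω i j) (hv : ∀ j, Measurable fun ω => v ω j) (i : Fin n) :
    Measurable fun ω => (P ω).mulVec (v ω) i :=
  Finset.measurable_fun_sum Finset.univ fun j _ => (hP i j).mul (hv j)

lemma measurable_mppX (hG : ∀ t, Measurable (G t)) (x₀ : Fin n → ℝ) {ε : ℕ → Ω → Fin n → ℝ}
    (hε : ∀ t, 1 ≤ t → Measurable (ε t)) (t : ℕ) (i : Fin n) :
    Measurable fun ω => mppX (fun s => G s ω) x₀ (fun s => ε s ω) t i := by
  induction t generalizing i with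
  | zero => exact measurable_const
  | succ t ih =>
    exact (measurable_mulVec (measurable_mppMatrix hG t) ih i).add
      ((measurable_pi_apply i).comp (hε (t + 1) (by omega)))

lemma measurable_mppZ (hG : ∀ t, Measurable (G t)) (x₀ : Fin n → ℝ) {ε : ℕ → Ω → Fin n → ℝ}
    (hε : ∀ t, 1 ≤ t → Measurable (ε t)) (t : ℕ) (i : Fin n) :
    Measurable fun ω => mppZ (fun s => G s ω) x₀ (fun s => ε s ω) (t + 1) i :=
  (measurable_mulVec (measurable_mppMatrix hG t) (measurable_mppX hG x₀ hε t) i).div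
    (measurable_mppY hG (t + 1) i)

lemma measurable_mppAvg (hG : ∀ t, Measurable (G t)) (x₀ : Fin n → ℝ) {ε : ℕ → Ω → Fin n → ℝ}
    (hε : ∀ t, 1 ≤ t → Measurable (ε t)) (t : ℕ) :
    Measurable fun ω => mppAvg (fun s => G s ω) x₀ (fun s => ε s ω) t :=
  (Finset.measurable_sum _ fun j _ => measurable_mppX hG x₀ hε t j).div_const _

end PerturbedPush

open PerturbedPush in
theorem lemma3 {n : ℕ} (hn : 2 ≤ n)
    {Ω : Type*} [MeasurableSpace Ω] (μ : Measure Ω) [IsProbabilityMeasure μ]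
    (G : ℕ → Ω → PerturbedPush.LoopDigraph n) (prob : PerturbedPush.LoopDigraph n → ℝ)
    (hG : PerturbedPush.RandomGraphAssumption μ G prob)
    (γ : ℝ) (hγ : 1 / 2 < γ) (hγ' : γ < 1) (U : ℝ) (hU : 0 < U)
    (x₀ : Fin n → ℝ) (ε : ℕ → Ω → Fin n → ℝ) (hε : ∀ t, 1 ≤ t → Measurable (ε t))
    (hεU : ∀ᵐ ω ∂μ, ∀ t : ℕ, 1 ≤ t → PerturbedPush.norm1 (ε t ω) ≤ U / (t : ℝ) ^ γ)
    (i : Fin n) (t : ℕ) :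
    let D : Ω → ℝ := fun ω =>
      1 / (∑ k ∈ Finset.range (t + 1), PerturbedPush.stepSize γ (k + 1)) *
        ∑ k ∈ Finset.range (t + 1), PerturbedPush.stepSize γ (k + 1) *
          |PerturbedPush.mppZ (fun s => G s ω) x₀ (fun s => ε s ω) (k + 1) i -
            PerturbedPush.mppAvg (fun s => G s ω) x₀ (fun s => ε s ω) k|
    Integrable D μ ∧
      ∫ ω, D ω ∂μ ≤
        2 * 15 * PerturbedPush.rate γ t /
            (PerturbedPush.delta n * (1 - PerturbedPush.lam prob)) *
          (PerturbedPush.norm1 x₀ + U * (1 + 1 / (2 * γ - 1))) := by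
  intro D
  have hconn : StronglyConnected (supportUnion prob) := hG.union_connected
  have hprob := exists_prob_pos hn hconn
  have hex : ∀ y : Fin n → ℝ, ∃ g : ℕ → LoopDigraph n, (∀ i, 0 ≤ y i) → ∑ i, y i = n →
      (∀ j < windowLength n, 0 < prob (g j)) ∧ ∀ v : Fin n → ℝ, ∑ i, v i = 0 →
        norm1 ((runMatrix ((List.range (windowLength n)).map g) y).mulVec v)
          ≤ (1 - gain n) * norm1 v := by
    intro y
    by_cases h : (∀ i, 0 ≤ y i) ∧ ∑ i, y i = n
    · obtain ⟨g, hg⟩ := exists_contracting_window hn hconn h.1 h.2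
      exact ⟨g, fun _ _ => hg⟩
    · exact ⟨fun _ => hprob.choose, fun h1 h2 => absurd ⟨h1, h2⟩ h⟩
  -- the favourable window of each mass vector; arbitrary on vectors that are not mass vectors
  choose σ hσ using hex
  have hσp : ∀ (g : ℕ → LoopDigraph n) (k : ℕ), ∀ j < windowLength n, 0 < prob (σ (mppY g k) j) :=
    fun g k => (hσ _ (fun i => (mppY_pos hn g k i).le) (sum_mppY g k)).1
  have hn0 : (0 : ℝ) < n := by positivity
  have hδ := delta_pos hn
  set e : ℕ → ℝ := fun s => U * stepSize γ (s + 1) with he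
  have he0 : ∀ s, 0 ≤ e s := fun s => mul_nonneg hU.le (stepSize_pos γ s).le
  set M : ℕ → Ω → ℝ := fun k ω => majorant σ (norm1 x₀) e (fun s => G s ω) k with hM
  have hMint : ∀ k, Integrable (M k) μ := fun k =>
    integrable_of_history hG.measurable fun _ _ => majorant_congr hn σ (norm1 x₀) e k
  set A := ∑ k ∈ Finset.range (t + 1), stepSize γ (k + 1) with hA
  have hA0 : 0 < A := Finset.sum_pos (fun k _ => stepSize_pos γ k) (by simp)
  have hAr : 1 / A ≤ rate γ t := one_div_sum_stepSize_le (by linarith) hγ' t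
  set D' : Ω → ℝ := fun ω => rate γ t * (n / delta n) *
    ∑ k ∈ Finset.range (t + 1), stepSize γ (k + 1) * M k ω with hD'
  have hD'int : Integrable D' μ :=
    (integrable_finsetSum _ fun k _ => (hMint k).const_mul _).const_mul _
  have hD0 : ∀ ω, 0 ≤ D ω := fun ω => mul_nonneg (one_div_pos.2 hA0).le
    (Finset.sum_nonneg fun k _ => mul_nonneg (stepSize_pos γ k).le (abs_nonneg _))
  have hDD' : ∀ᵐ ω ∂μ, D ω ≤ D' ω := by
    filter_upwards [hεU] with ω hω
    have hbound : ∀ k, norm1 (disagreement (fun s => G s ω) x₀ (fun s => ε s ω) k) ≤ M k ω :=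
      norm1_disagreement_le_majorant hn
        (fun y hy hys => (hσ y hy hys).2) (fun s => G s ω) x₀ (ε := fun s => ε s ω) (e := e)
        fun s => (hω (s + 1) (by omega)).trans (le_of_eq (by simp [he, stepSize, div_eq_mul_inv]))
    calc D ω ≤ rate γ t * ∑ k ∈ Finset.range (t + 1), stepSize γ (k + 1) *
          (n / delta n * M k ω) := by
          refine mul_le_mul hAr (Finset.sum_le_sum fun k _ => ?_) (Finset.sum_nonneg fun k _ =>
            mul_nonneg (stepSize_pos γ k).le (abs_nonneg _)) ((one_div_pos.2 hA0).le.trans hAr)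
          refine mul_le_mul_of_nonneg_left ?_ (stepSize_pos γ k).le
          exact (abs_mppZ_sub_mppAvg_le hn _ x₀ _ k i).trans
            (mul_le_mul_of_nonneg_left (hbound k) (by positivity))
      _ = D' ω := by
          simp only [hD']
          rw [mul_assoc, Finset.mul_sum (a := (n : ℝ) / delta n)]
          congr 1
          exact Finset.sum_congr rfl fun k _ => mul_left_comm _ _ _
  have hDmeas : Measurable D := (Finset.measurable_sum _ fun k _ =>
    ((measurable_mppZ hG.measurable x₀ hε k i).sub
      (measurable_mppAvg hG.measurable x₀ hε k)).abs.const_mul _).const_mul _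
  have hDint : Integrable D μ := by
    refine hD'int.mono' hDmeas.aestronglyMeasurable ?_
    filter_upwards [hDD'] with ω hω
    rwa [Real.norm_of_nonneg (hD0 ω)]
  refine ⟨hDint, (integral_mono_ae hDint hD'int hDD').trans ?_⟩
  have hp0 : 0 < windowProb prob := pow_pos (minProb_pos hprob) _
  have hp1 : windowProb prob ≤ 1 := pow_le_one₀ (minProb_pos hprob).le (minProb_le_one hG hprob)
  set c := gain n * windowProb prob with hc
  have hc0 : 0 < c := mul_pos (gain_pos hn) hp0
  have hsum := mul_sum_stepSize_mul_le hγ (B := windowLength n) (c := c) (X := norm1 x₀) (U := U)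
    (mul_le_one₀ (gain_le_one hn) hp0.le hp1) (norm1_nonneg x₀) hU.le (a := fun k => ∫ ω, M k ω ∂μ)
    (fun k => integral_nonneg fun ω => majorant_nonneg hn σ (norm1_nonneg x₀) he0 _ k)
    (fun k hk => by simp [hM, majorant_of_lt _ _ _ _ hk, he])
    (fun k => integral_majorant_add_le hn hG hprob hσp (norm1_nonneg x₀) he0 k) (t + 1)
  have hD'eq : ∫ ω, D' ω ∂μ = rate γ t * (n / delta n) *
      ∑ k ∈ Finset.range (t + 1), stepSize γ (k + 1) * ∫ ω, M k ω ∂μ := by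
    rw [hD', integral_const_mul, integral_finsetSum _ fun k _ => (hMint k).const_mul _]
    simp only [integral_const_mul]
  rw [hD'eq]
  set S := ∑ k ∈ Finset.range (t + 1), stepSize γ (k + 1) * ∫ ω, M k ω ∂μ
  set K := norm1 x₀ + U * (1 + 1 / (2 * γ - 1))
  have hK0 : 0 ≤ K := by
    have : 0 < 1 / (2 * γ - 1) := by apply one_div_pos.2; linarith
    exact add_nonneg (norm1_nonneg x₀) (by positivity)
  obtain ⟨hl1, hl2⟩ := lam_bounds hn hp0 hp1
  have hl0 : 0 < 1 - lam prob := by linarith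
  have hrate : 0 ≤ rate γ t := (one_div_pos.2 hA0).le.trans hAr
  have hnS : n * S * (1 - lam prob) ≤ 30 * K := by
    refine le_of_mul_le_mul_left ?_ hc0
    calc c * (n * S * (1 - lam prob)) = (c * S) * (n * (1 - lam prob)) := by ring
      _ ≤ (4 * windowLength n * K) * (n * (1 - lam prob)) :=
          mul_le_mul_of_nonneg_right hsum (by positivity)
      _ = (1 - lam prob) * (4 * n * windowLength n) * K := by ring
      _ ≤ 30 * c * K := mul_le_mul_of_nonneg_right hl2 hK0
      _ = c * (30 * K) := by ring
  calc rate γ t * (n / delta n) * S = rate γ t / delta n * (n * S) := by ring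
    _ ≤ rate γ t / delta n * (30 * K / (1 - lam prob)) :=
        mul_le_mul_of_nonneg_left ((le_div_iff₀ hl0).2 hnS) (by positivity)
    _ = 2 * 15 * rate γ t / (delta n * (1 - lam prob)) * K := by
        field_simp
        ring
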